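/- Let "Lie algebra" mean Lie algebra over some commutative ring with unity. There is a function $f:\mathbb N^3\to\mathbb N$ with the following property. Let $A$ be an additively written abelian group (finite or infinite) and let $L=\bigoplus_{a\in A}L_a$ be an $A$-graded Lie algebra, so that $[L_a,L_b]\subseteq L_{a+b}$ for all $a,b\in A$. Let $H$ be a finite group of double automorphisms of $L$, that is, a finite subgroup of $\operatorname{Aut}L$ acting on $A$ by group automorphisms $a\mapsto a^h$ in such a way that $(L_a)^h=L_{a^h}$ for all $a\in A$ and $h\in H$. Let $k,c\ge 0$ be integers and assume that 1. every component $L_a$, $a\in A$, is ad-nilpotent of index at most $k$, that is, $[L,\underbrace{L_a,\ldots,L_a}_{k}]=0$ (left-normed commutators); 2. $C_A(h)=\{a\in A : a^h=a\}=0$ for every nontrivial $h\in H$; 3. the fixed-point subalgebra $C_L(H)=\{l\in L : l^h=l \text{ for all } h\in H\}$ is nilpotent of class at most $c$. Then $L$ is nilpotent of class at most $f(|H|,k,c)$. -/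

import Mathlib

/-- The group `Aut L` of automorphisms of a Lie algebra `L`; the product is composition. -/
instance LieEquiv.instAutGroup {R L : Type*} [CommRing R] [LieRing L] [LieAlgebra R L] :
    Group (L ≃ₗ⁅R⁆ L) where
  mul f g := g.trans f
  one := 1
  inv f := f.symm
  mul_assoc _ _ _ := rfl
  one_mul _ := rfl
  mul_one _ := rfl
  inv_mul_cancel f := DFunLike.ext _ _ fun x => f.symm_apply_apply x

/-- The subalgebra `C_L(H)` of the elements of `L` fixed by every automorphism in `H`. -/
def lieFixedPoints {R L : Type*} [CommRing R] [LieRing L] [LieAlgebra R L]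
    (H : Subgroup (L ≃ₗ⁅R⁆ L)) : LieSubalgebra R L where
  carrier := {x | ∀ φ ∈ H, φ x = x}
  zero_mem' := fun φ _ => map_zero φ
  add_mem' := fun {x y} hx hy φ hφ => by rw [map_add, hx φ hφ, hy φ hφ]
  smul_mem' := fun r x hx φ hφ => by rw [map_smul, hx φ hφ]
  lie_mem' := fun {x y} hx hy φ hφ => by
    rw [LieEquiv.map_lie, hx φ hφ, hy φ hφ]

/-- The left-normed commutator `[x, y₁, …, yₙ] = [… [[x, y₁], y₂], …, yₙ]`. -/
def leftNormed {L : Type*} [LieRing L] (x : L) (ys : List L) : L :=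
  ys.foldl (fun u v => ⁅u, v⁆) x

/-- The subspace `K` of `L` is ad-nilpotent of index (at most) `n`: `[L, K, …, K] = 0`, where `K`
occurs `n` times. -/
def IsAdNilpotentOfIndex {R L : Type*} [CommRing R] [LieRing L] [LieAlgebra R L]
    (K : Submodule R L) (n : ℕ) : Prop :=
  ∀ (x : L) (ys : List L), ys.length = n → (∀ y ∈ ys, y ∈ K) → leftNormed x ys = 0

/-- The Lie algebra `L` is nilpotent of class (at most) `n`: the `n`-th term of the lower central
series, which starts with `L` as its `0`-th term, vanishes. -/
def IsLieNilpotentOfClass (R L : Type*) [CommRing R] [LieRing L] [LieAlgebra R L] (n : ℕ) : Prop :=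
  LieModule.lowerCentralSeries R L L n = ⊥

/-- The group `H` of automorphisms of the `A`-graded Lie algebra `L = ⨁ a, ℒ a`, together with an
action of `H` on `A` by group automorphisms, is a group of double automorphisms: every `h` in `H`
maps the component of degree `a` onto the component of degree `h • a`. -/
def IsGroupOfDoubleAut {R L A : Type*} [CommRing R] [LieRing L] [LieAlgebra R L] [AddCommGroup A]
    (ℒ : A → Submodule R L) (H : Subgroup (L ≃ₗ⁅R⁆ L)) [DistribMulAction H A] : Prop :=
  ∀ (h : H) (a : A), (ℒ a).map ((h : L ≃ₗ⁅R⁆ L) : L →ₗ[R] L) = ℒ (h • a)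

/-! Call degrees a₁, …, aₙ independent if their sum is not also a sum of elements hᵢ • aᵢ with some
hᵢ ≠ 1. For xᵢ of degree aᵢ, replace each xᵢ by its trace over `H`, which is a fixed point. A
commutator of c + 1 traces is 0, and expanding it expresses the commutator of the xᵢ through terms
of twisted degrees; if the degrees are independent, it vanishes
(`commSpace_eq_bot_of_isOrbitIndependent`). Since h ≠ 1 fixes only 0, an independent list extends by
all but boundedly many degrees (`IsOrbitIndependent.exists_finset`). So, by downward induction on
length, an independent commutator u is centralized by all but boundedly many components modulo a
bounded term of the upper central series, and `exists_mem_ucs` puts u itself into a bounded term.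
The empty list yields all of `L`.

The core is `exists_mem_ucs`. Words in the components applied to u may be permuted modulo shorter
words of the same degree, so u generates a submodule with boundedly many degrees. On it `L` acts
through boundedly many nilpotent components, and these generate a nilpotent associative algebra
(`exists_iSup_pow_eq_bot`). That is proved by induction on the number of generators of a subgroup
containing the support: factoring out all generators but one leaves a cyclic grading whose zero
component is nilpotent by induction, Kreknin's elimination (`IsKreknin.iterate_eq_bot`) gives
solvability, and a collection argument (`iSup_pow_eq_bot_of_solvable`) turns this into nilpotency.
-/

/-! ### Families of submodules and their derived families. -/

section LieFamily

variable {R L M C : Type*} [CommRing R] [LieRing L] [LieAlgebra R L] [AddCommGroup M] [Module R M]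
  [LieRingModule L M] [LieModule R L M]

/-- The span of all `⁅x, m⁆` with `x ∈ P` and `m ∈ Q`. -/
def lieProd (P : Submodule R L) (Q : Submodule R M) : Submodule R M :=
  Submodule.map₂ (LieModule.toEnd R L M : L →ₗ[R] M →ₗ[R] M) P Q

theorem lieProd_le {P : Submodule R L} {Q N : Submodule R M} :
    lieProd P Q ≤ N ↔ ∀ x ∈ P, ∀ m ∈ Q, ⁅x, m⁆ ∈ N :=
  Submodule.map₂_le

theorem lie_mem_lieProd {P : Submodule R L} {Q : Submodule R M} {x : L} {m : M} (hx : x ∈ P)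
    (hm : m ∈ Q) : ⁅x, m⁆ ∈ lieProd P Q :=
  Submodule.apply_mem_map₂ (LieModule.toEnd R L M : L →ₗ[R] M →ₗ[R] M) hx hm

theorem lieProd_mono {P P' : Submodule R L} {Q Q' : Submodule R M} (hP : P ≤ P') (hQ : Q ≤ Q') :
    lieProd P Q ≤ lieProd P' Q' :=
  Submodule.map₂_le_map₂ hP hQ

theorem lieProd_iterate_mono {P P' : Submodule R L} {Q Q' : Submodule R M} (hP : P ≤ P')
    (hQ : Q ≤ Q') (n : ℕ) : (lieProd P)^[n] Q ≤ (lieProd P')^[n] Q' := by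
  induction n with
  | zero => exact hQ
  | succ n ih =>
    rw [Function.iterate_succ_apply', Function.iterate_succ_apply']
    exact lieProd_mono hP ih

theorem lieProd_sup (P : Submodule R L) (Q Q' : Submodule R M) :
    lieProd P (Q ⊔ Q') = lieProd P Q ⊔ lieProd P Q' :=
  Submodule.map₂_sup_right _ _ _ _

theorem lieProd_bot (P : Submodule R L) : lieProd P (⊥ : Submodule R M) = ⊥ :=
  Submodule.map₂_bot_right _ _

theorem lieProd_iSup_left {ι : Sort*} (P : ι → Submodule R L) (Q : Submodule R M) :
    lieProd (⨆ i, P i) Q = ⨆ i, lieProd (P i) Q :=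
  Submodule.map₂_iSup_left _ _ _

theorem lieProd_iSup_right {ι : Sort*} (P : Submodule R L) (Q : ι → Submodule R M) :
    lieProd P (⨆ i, Q i) = ⨆ i, lieProd P (Q i) :=
  Submodule.map₂_iSup_right _ _ _

theorem lieProd_comm (P Q : Submodule R L) : lieProd P Q = lieProd Q P := by
  have h : ∀ P Q : Submodule R L, lieProd P Q ≤ lieProd Q P := fun P Q =>
    lieProd_le.2 fun x hx y hy => by
      rw [← lie_skew]
      exact neg_mem (lie_mem_lieProd hy hx)
  exact le_antisymm (h P Q) (h Q P)

variable [AddCommGroup C]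

/-- A family of submodules of a Lie algebra, indexed by an additive group, with
`[K s, K t] ⊆ K (s + t)`. -/
def IsLieFamily (K : C → Submodule R L) : Prop :=
  ∀ s t, lieProd (K s) (K t) ≤ K (s + t)

theorem IsLieFamily.lie_mem {K : C → Submodule R L} (hK : IsLieFamily K) {s t : C} {x y : L}
    (hx : x ∈ K s) (hy : y ∈ K t) : ⁅x, y⁆ ∈ K (s + t) :=
  hK s t (lie_mem_lieProd hx hy)

/-- The componentwise derived family of a family of submodules of a Lie algebra. -/
def derivedFamily (K : C → Submodule R L) (c : C) : Submodule R L :=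
  ⨆ s, lieProd (K s) (K (c - s))

theorem lieProd_le_derivedFamily (K : C → Submodule R L) (s t : C) :
    lieProd (K s) (K t) ≤ derivedFamily K (s + t) := by
  have h := le_iSup (fun r => lieProd (K r) (K (s + t - r))) s
  simpa [derivedFamily] using h

theorem IsLieFamily.derivedFamily_le {K : C → Submodule R L} (hK : IsLieFamily K) :
    derivedFamily K ≤ K := fun c => iSup_le fun s => by
  simpa using hK s (c - s)

theorem IsLieFamily.derivedFamily {K : C → Submodule R L} (hK : IsLieFamily K) :
    IsLieFamily (derivedFamily K) := fun s t =>
  (lieProd_mono (hK.derivedFamily_le s) (hK.derivedFamily_le t)).trans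
    (lieProd_le_derivedFamily K s t)

theorem IsLieFamily.iterate {K : C → Submodule R L} (hK : IsLieFamily K) (n : ℕ) :
    IsLieFamily (_root_.derivedFamily^[n] K) := by
  induction n with
  | zero => exact hK
  | succ n ih =>
    rw [Function.iterate_succ_apply']
    exact ih.derivedFamily

theorem IsLieFamily.iterate_le {K : C → Submodule R L} (hK : IsLieFamily K) (n : ℕ) :
    _root_.derivedFamily^[n] K ≤ K := by
  induction n with
  | zero => exact le_rfl
  | succ n ih =>
    rw [Function.iterate_succ_apply']
    exact (hK.iterate n).derivedFamily_le.trans ih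

/-- The derived families of a coarser family contain those of a finer one. -/
theorem derivedFamily_iterate_le_of_le {A : Type*} [AddCommGroup A] (f : A →+ C)
    {V : A → Submodule R L} {W : C → Submodule R L} (h : ∀ a, V a ≤ W (f a)) (n : ℕ) (a : A) :
    derivedFamily^[n] V a ≤ derivedFamily^[n] W (f a) := by
  induction n generalizing a with
  | zero => exact h a
  | succ n ih =>
    rw [Function.iterate_succ_apply', Function.iterate_succ_apply']
    refine iSup_le fun s => (lieProd_mono (ih s) (ih (a - s))).trans ?_
    simpa using lieProd_le_derivedFamily (derivedFamily^[n] W) (f s) (f (a - s))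

/-! ### Kreknin's elimination of components. -/

/-- A Lie family supported in `S` whose zero component acts nilpotently. -/
structure IsKreknin (S : Finset C) (l : ℕ) (K : C → Submodule R L) : Prop where
  lieFamily : IsLieFamily K
  support : ∀ c ∉ S, K c = ⊥
  nil : ∀ c, (lieProd (K 0))^[l] (K c) = ⊥

theorem IsKreknin.mono {S : Finset C} {l : ℕ} {K K' : C → Submodule R L} (hK : IsKreknin S l K)
    (h : IsLieFamily K') (hle : K' ≤ K) : IsKreknin S l K' where
  lieFamily := h
  support c hc := le_bot_iff.1 ((hle c).trans (hK.support c hc).le)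
  nil c := le_bot_iff.1 ((lieProd_iterate_mono (hle 0) (hle c) l).trans (hK.nil c).le)

theorem IsKreknin.iterate {S : Finset C} {l : ℕ} {K : C → Submodule R L} (hK : IsKreknin S l K)
    (n : ℕ) : IsKreknin S l (derivedFamily^[n] K) :=
  hK.mono (hK.lieFamily.iterate n) (hK.lieFamily.iterate_le n)

/-- A bound for the number of derivations needed to eliminate `i` components. -/
def krekninBound (l : ℕ) : ℕ → ℕ
  | 0 => 0
  | i + 1 => krekninBound l i + l * (krekninBound l i + 1)

/-- If the family `K` is generated by the components in `B`, then commutators in degree `c` can be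
written with a last entry in one of these components. -/
theorem derivedFamily_le_of_generated {K D : C → Submodule R L} (hK : IsLieFamily K) (B : Set C)
    (hD : D ≤ K)
    (h : ∀ G : C → Submodule R L, IsLieFamily G → (∀ b ∈ B, K b ≤ G b) → D ≤ G) (c : C) :
    derivedFamily D c ≤ ⨆ s ∈ B, lieProd (K (c - s)) (K s) := by
  set Q : C → Submodule R L := fun c => ⨆ s ∈ B, lieProd (K (c - s)) (K s) with hQ
  have hQmem : ∀ (i b : C), b ∈ B → lieProd (K i) (K b) ≤ Q (i + b) := fun i b hb => by
    have := le_iSup₂ (f := fun s (_ : s ∈ B) => lieProd (K (i + b - s)) (K s)) b hb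
    simpa [hQ] using this
  -- The elements whose brackets with all of `K` land in `Q`. By the Jacobi identity they form a Lie
  -- family, and it contains the generators.
  let G : C → Submodule R L := fun j =>
    { carrier := {y | y ∈ K j ∧ ∀ i, ∀ x ∈ K i, ⁅x, y⁆ ∈ Q (i + j)}
      zero_mem' := ⟨zero_mem _, fun i x _ => by rw [lie_zero]; exact zero_mem _⟩
      add_mem' := fun hy hz => ⟨add_mem hy.1 hz.1, fun i x hx => by
        rw [lie_add]; exact add_mem (hy.2 i x hx) (hz.2 i x hx)⟩
      smul_mem' := fun r y hy => ⟨Submodule.smul_mem _ _ hy.1, fun i x hx => by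
        rw [lie_smul]; exact Submodule.smul_mem _ _ (hy.2 i x hx)⟩ }
  have hG : IsLieFamily G := fun s t => lieProd_le.2 fun y hy z hz => by
    refine ⟨hK.lie_mem hy.1 hz.1, fun i x hx => ?_⟩
    rw [leibniz_lie, ← lie_skew y]
    refine add_mem ?_ (neg_mem ?_)
    · have := hz.2 (i + s) _ (hK.lie_mem hx hy.1)
      rwa [add_assoc] at this
    · have := hy.2 (i + t) _ (hK.lie_mem hx hz.1)
      rwa [add_assoc, add_comm t s] at this
  have hDG := h G hG fun b hb y hy =>
    ⟨hy, fun i x hx => hQmem i b hb (lie_mem_lieProd hx hy)⟩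
  refine iSup_le fun s => lieProd_le.2 fun x hx y hy => ?_
  have := (hDG (c - s) hy).2 s x (hD s hx)
  simpa [hQ] using this

/-- The elimination argument of Kreknin. -/
theorem IsKreknin.iterate_le_of_generated {S : Finset C} {l : ℕ} {ρ : C → ℕ}
    (hρ : ∀ s ∈ S, ∀ t ∈ S, ∀ u ∈ S, s + u = t → s ≠ t → ρ t ≤ ρ s → ρ t < ρ u) (i : ℕ) :
    ∀ T : Finset C, T.card = i → T ⊆ S → 0 ∉ T →
      (∀ t ∈ T, ∀ s ∈ S, s ≠ 0 → ρ s < ρ t → s ∈ T) →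
      ∀ K : C → Submodule R L, IsKreknin S l K → ∀ G : C → Submodule R L, IsLieFamily G →
      (∀ b ∉ T, K b ≤ G b) → derivedFamily^[krekninBound l i] K ≤ G := by
  classical
  induction i with
  | zero =>
    intro T hT _ _ _ K _ G _ h
    rw [Finset.card_eq_zero] at hT
    subst hT
    exact fun b => h b (by simp)
  | succ i ih =>
    intro T hT hTS h0 hinit K hK G hG hKG
    obtain ⟨t, htT, htmax⟩ := T.exists_max_image ρ (Finset.card_pos.1 (by omega))
    have ht0 : t ≠ 0 := fun h => h0 (h ▸ htT)
    set m := krekninBound l i with hm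
    have key : ∀ K : C → Submodule R L, IsKreknin S l K → ∀ G : C → Submodule R L,
        IsLieFamily G → (∀ b ∉ T.erase t, K b ≤ G b) → derivedFamily^[m] K ≤ G := by
      refine ih (T.erase t) (by rw [Finset.card_erase_of_mem htT]; omega)
        ((T.erase_subset t).trans hTS) (fun h => h0 (Finset.mem_of_mem_erase h)) ?_
      intro u hu s hs hs0 hsu
      have huT := Finset.mem_of_mem_erase hu
      refine Finset.mem_erase.2 ⟨?_, hinit u huT s hs hs0 hsu⟩
      rintro rfl
      exact absurd (htmax u huT) (by omega)
    -- Every m + 1 derivations trade one more factor `K 0` for an error in `G t`; after `l` rounds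
    -- only `G t` remains.
    have step : ∀ j, derivedFamily^[j * (m + 1)] K t ≤ G t ⊔ (lieProd (K 0))^[j] (K t) := by
      intro j
      induction j with
      | zero => simp
      | succ j ihj =>
        set K' := derivedFamily^[j * (m + 1)] K with hK'
        have hKr : IsKreknin S l K' := hK.iterate _
        have hle : K' ≤ K := hK.lieFamily.iterate_le _
        have e : (j + 1) * (m + 1) = (m + 1) + j * (m + 1) := by ring
        rw [e, Function.iterate_add_apply, Function.iterate_succ_apply', ← hK']
        refine (derivedFamily_le_of_generated (K := K') hKr.lieFamily {b | b ∉ T.erase t}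
          (hKr.lieFamily.iterate_le m) (fun G hG h => key K' hKr G hG h) t).trans ?_
        have hzero : lieProd (K' 0) (K' t) ≤ G t ⊔ (lieProd (K 0))^[j + 1] (K t) := by
          rw [Function.iterate_succ_apply']
          refine (lieProd_mono (hle 0) ihj).trans ?_
          rw [lieProd_sup]
          refine sup_le_sup_right ?_ _
          have := hG 0 t
          rw [zero_add] at this
          exact (lieProd_mono (hKG 0 h0) le_rfl).trans this
        refine iSup₂_le fun s hs => ?_
        by_cases hs0 : s = 0
        · subst hs0
          rw [sub_zero, lieProd_comm]
          exact hzero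
        by_cases hst : s = t
        · subst hst
          rw [sub_self]
          exact hzero
        by_cases hsS : s ∈ S
        swap
        · rw [hKr.support s hsS, lieProd_bot]
          exact bot_le
        by_cases huS : t - s ∈ S
        swap
        · rw [hKr.support _ huS, lieProd_comm, lieProd_bot]
          exact bot_le
        have hsT : s ∉ T := fun h => hs (Finset.mem_erase.2 ⟨hst, h⟩)
        have hts : ρ t ≤ ρ s := by
          by_contra! h
          exact hsT (hinit t htT s hsS hs0 h)
        -- As s is outside the initial segment `T`, its rank is at least that of t, so t - s has
        -- rank above the maximum over `T`. Both factors then lie in `G`.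
        have htu := hρ s hsS t (hTS htT) (t - s) huS (by abel) hst hts
        have huT : t - s ∉ T := fun h => absurd (htmax _ h) (by omega)
        refine le_sup_of_le_left ?_
        have := hG (t - s) s
        rw [sub_add_cancel] at this
        exact (lieProd_mono ((hle _).trans (hKG _ huT)) ((hle _).trans (hKG _ hsT))).trans this
    have hbound : krekninBound l (i + 1) = m + l * (m + 1) := rfl
    rw [hbound, Function.iterate_add_apply]
    refine key _ (hK.iterate _) G hG fun b hb => ?_
    by_cases hbt : b = t
    · subst hbt
      have := step l
      rwa [hK.nil, sup_bot_eq] at this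
    · exact (hK.lieFamily.iterate_le _ b).trans
        (hKG b fun h => hb (Finset.mem_erase.2 ⟨hbt, h⟩))

/-- A generalization of Kreknin's theorem: a Lie family with bounded support in a suitably ordered
group, the zero component of which acts nilpotently, is solvable of bounded derived length. -/
theorem IsKreknin.iterate_eq_bot {S : Finset C} {l : ℕ} {ρ : C → ℕ}
    (hρ : ∀ s ∈ S, ∀ t ∈ S, ∀ u ∈ S, s + u = t → s ≠ t → ρ t ≤ ρ s → ρ t < ρ u)
    {K : C → Submodule R L} (hK : IsKreknin S l K) {d : ℕ} (hd : S.card ≤ d) :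
    derivedFamily^[l + krekninBound l d] K = ⊥ := by
  classical
  set m := krekninBound l (S.erase 0).card with hm
  have h1 : derivedFamily^[m] K ≤ fun _ => K 0 := by
    -- The constant family `K 0` serves as `G`: eliminating all nonzero degrees pushes every
    -- component into `K 0`, where nilpotency applies.
    refine IsKreknin.iterate_le_of_generated hρ _ (S.erase 0) rfl (S.erase_subset 0) (by simp)
      (fun t _ s hs hs0 _ => Finset.mem_erase.2 ⟨hs0, hs⟩) K hK _ (fun _ _ => ?_) fun b hb => ?_
    · simpa using hK.lieFamily 0 0
    · by_cases hb0 : b = 0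
      · rw [hb0]
      · rw [hK.support b fun h => hb (Finset.mem_erase.2 ⟨hb0, h⟩)]
        exact bot_le
  have h2 : ∀ j c, derivedFamily^[j + m] K c ≤ (lieProd (K 0))^[j] (K 0) := by
    intro j
    induction j with
    | zero => intro c; simpa using h1 c
    | succ j ih =>
      intro c
      rw [add_right_comm, Function.iterate_succ_apply', Function.iterate_succ_apply']
      refine iSup_le fun s => lieProd_mono ?_ (ih _)
      rw [Function.iterate_add_apply]
      exact ((hK.lieFamily.iterate m).iterate_le j s).trans (h1 s)
  have hmono : Monotone (krekninBound l) := monotone_nat_of_le_succ fun i => Nat.le_add_right _ _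
  obtain ⟨r, hr⟩ := Nat.exists_eq_add_of_le
    (hmono ((Finset.card_le_card (S.erase_subset 0)).trans hd))
  funext c
  have e : l + krekninBound l d = r + (l + m) := by omega
  rw [e, Function.iterate_add_apply]
  exact le_bot_iff.1 (((hK.lieFamily.iterate (l + m)).iterate_le r c).trans
    ((h2 l c).trans (hK.nil 0).le))

end LieFamily

/-! ### Ranks from residues in a cyclic group. -/

section Rank

/-- A finite subset of a cyclic group, reduced modulo a suitable integer, has a rank function that
makes the elimination argument of Kreknin work. -/
theorem exists_kreknin_rank {C : Type*} [AddCommGroup C] (g : C) (S : Finset C)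
    (hS : ∀ s ∈ S, s ∈ AddSubgroup.zmultiples g) :
    ∃ ρ : C → ℕ, ∀ s ∈ S, ∀ t ∈ S, ∀ u ∈ S, s + u = t → s ≠ t → ρ t ≤ ρ s → ρ t < ρ u := by
  classical
  have hz : ∀ s : C, ∃ z : ℤ, s ∈ S → z • g = s := fun s => by
    by_cases h : s ∈ S
    · obtain ⟨z, hz⟩ := AddSubgroup.mem_zmultiples_iff.1 (hS s h)
      exact ⟨z, fun _ => hz⟩
    · exact ⟨0, fun h' => absurd h' h⟩
  choose z hz using hz
  obtain ⟨N, hN, hadd, hinj⟩ : ∃ N : ℤ, 0 < N ∧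
      (∀ s ∈ S, ∀ t ∈ S, ∀ u ∈ S, s + u = t → N ∣ z s + z u - z t) ∧
      (∀ s ∈ S, ∀ t ∈ S, N ∣ z s - z t → s = t) := by
    have hdvd : ∀ s ∈ S, ∀ t ∈ S, ∀ u ∈ S, s + u = t →
        (addOrderOf g : ℤ) ∣ z s + z u - z t := by
      intro s hs t ht u hu h
      rw [addOrderOf_dvd_iff_zsmul_eq_zero, sub_zsmul, add_zsmul, hz s hs, hz t ht, hz u hu, h]
      simp
    rcases Nat.eq_zero_or_pos (addOrderOf g) with h0 | hpos
    · rw [h0] at hdvd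
      -- For an infinite cyclic group, this modulus exceeds every difference of exponents, so
      -- residues still separate `S`.
      refine ⟨2 * ∑ s ∈ S, |z s| + 1, ?_, ?_, ?_⟩
      · have := Finset.sum_nonneg fun s (_ : s ∈ S) => abs_nonneg (z s)
        omega
      · intro s hs t ht u hu h
        have := hdvd s hs t ht u hu h
        rw [Nat.cast_zero, zero_dvd_iff] at this
        rw [this]
        exact dvd_zero _
      · intro s hs t ht h
        have h1 := Finset.single_le_sum (fun s (_ : s ∈ S) => abs_nonneg (z s)) hs
        have h2 := Finset.single_le_sum (fun s (_ : s ∈ S) => abs_nonneg (z s)) ht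
        have h3 : |z s - z t| < 2 * ∑ s ∈ S, |z s| + 1 := by
          have := abs_sub (z s) (z t)
          omega
        have h4 := Int.eq_zero_of_abs_lt_dvd h h3
        rw [← hz s hs, ← hz t ht, sub_eq_zero.1 h4]
    · refine ⟨addOrderOf g, by exact_mod_cast hpos, hdvd, fun s hs t ht h => ?_⟩
      rw [addOrderOf_dvd_iff_zsmul_eq_zero, sub_zsmul, hz s hs, hz t ht] at h
      simpa [add_neg_eq_zero] using h
  refine ⟨fun c => (z c % N).toNat, fun s hs t ht u hu h hne hle => ?_⟩
  have hs0 := Int.emod_nonneg (z s) hN.ne'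
  have ht0 := Int.emod_nonneg (z t) hN.ne'
  have hu0 := Int.emod_nonneg (z u) hN.ne'
  have hsN := Int.emod_lt_of_pos (z s) hN
  have hne' : z s % N ≠ z t % N := fun e => hne (hinj s hs t ht
    (Int.ModEq.dvd (show z t % N = z s % N from e.symm)))
  have hmod : N ∣ z s % N + z u % N - z t % N := by
    have h1 := hadd s hs t ht u hu h
    have h2 : z s % N + z u % N - z t % N =
        z s + z u - z t - N * (z s / N + z u / N - z t / N) := by
      rw [Int.emod_def, Int.emod_def, Int.emod_def]; ring
    rw [h2]
    exact dvd_sub h1 (dvd_mul_right _ _)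
  obtain ⟨q, hq⟩ := hmod
  replace hle : (z t % N).toNat ≤ (z s % N).toNat := hle
  -- The residues satisfy s + u = t + N q with s > t, which forces q ≥ 1; then s < N gives u > t.
  have hq1 : 0 < q := by
    by_contra! hq0
    have : N * q ≤ 0 := mul_nonpos_of_nonneg_of_nonpos hN.le hq0
    omega
  have : N ≤ N * q := le_mul_of_one_le_right hN.le hq1
  show (z t % N).toNat < (z u % N).toNat
  omega

end Rank

/-! ### From solvability to associative nilpotency. -/

section Solvable

attribute [local instance] LieRing.ofAssociativeRing

variable {R E A : Type*} [CommRing R] [Ring E] [Algebra R E]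

/-- The factor `Q` absorbs the letters peeled off on the right, so the induction reduces a power of
a sum to monomials. -/
theorem Submodule.iSup_pow_mul_le {ι : Type*} (V : ι → Submodule R E) (J : Submodule R E) :
    ∀ (n : ℕ) (Q : Submodule R E),
      (∀ l : List ι, l.length = n → (l.map V).prod * Q ≤ J) → (⨆ a, V a) ^ n * Q ≤ J
  | 0, Q, h => by simpa using h [] rfl
  | n + 1, Q, h => by
    rw [pow_succ, mul_assoc]
    refine iSup_pow_mul_le V J n _ fun l hl => ?_
    rw [Submodule.iSup_mul, Submodule.mul_iSup]
    refine iSup_le fun a => ?_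
    have := h (l ++ [a]) (by simp [hl])
    simpa [mul_assoc] using this

theorem mul_le_of_lie_le {P Q W : Submodule R E} (h : lieProd (L := E) (M := E) P Q ≤ W) : P * Q ≤ Q * P ⊔ W := by
  refine Submodule.mul_le.2 fun x hx y hy => ?_
  have e : x * y = y * x + ⁅x, y⁆ := by rw [LieRing.of_associative_ring_bracket]; abel
  rw [e]
  exact add_mem (Submodule.mem_sup_left (Submodule.mul_mem_mul hy hx))
    (Submodule.mem_sup_right (h (lie_mem_lieProd hx hy)))

theorem lieProd_le_mul (P Q : Submodule R E) : lieProd (L := E) (M := E) P Q ≤ P * Q ⊔ Q * P :=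
  lieProd_le.2 fun x hx y hy => by
    rw [LieRing.of_associative_ring_bracket]
    exact sub_mem (Submodule.mem_sup_left (Submodule.mul_mem_mul hx hy))
      (Submodule.mem_sup_right (Submodule.mul_mem_mul hy hx))

/-- Nilpotent submodules act nilpotently by commutation. -/
theorem lieProd_iterate_eq_bot {P : Submodule R E} {n : ℕ} (hP : P ^ n = ⊥) (Q : Submodule R E) :
    (lieProd (L := E) (M := E) P)^[2 * n] Q = ⊥ := by
  have h : ∀ i, (lieProd (L := E) (M := E) P)^[i] Q ≤ ⨆ p ∈ Finset.HasAntidiagonal.antidiagonal i, P ^ p.1 * Q * P ^ p.2 := by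
    intro i
    induction i with
    | zero => simp
    | succ i ih =>
      rw [Function.iterate_succ_apply']
      refine (lieProd_mono le_rfl ih).trans ((lieProd_le_mul _ _).trans (sup_le ?_ ?_))
      · simp only [Submodule.mul_iSup]
        refine iSup₂_le fun p hp => ?_
        refine le_iSup₂_of_le (p.1 + 1, p.2) ?_ ?_
        · rw [Finset.HasAntidiagonal.mem_antidiagonal] at hp ⊢; simp only; omega
        · simp only [pow_succ', mul_assoc]; exact le_rfl
      · simp only [Submodule.iSup_mul]
        refine iSup₂_le fun p hp => ?_
        refine le_iSup₂_of_le (p.1, p.2 + 1) ?_ ?_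
        · rw [Finset.HasAntidiagonal.mem_antidiagonal] at hp ⊢; simp only; omega
        · simp only [pow_succ, mul_assoc]; exact le_rfl
  have hpow : ∀ m, n ≤ m → P ^ m = ⊥ := fun m hm => by
    obtain ⟨r, rfl⟩ := Nat.exists_eq_add_of_le hm
    rw [pow_add, hP, Submodule.bot_mul]
  refine le_bot_iff.1 ((h _).trans (iSup₂_le fun p hp => ?_))
  rw [Finset.HasAntidiagonal.mem_antidiagonal] at hp
  rcases le_or_gt n p.1 with h1 | h1
  · rw [hpow _ h1, Submodule.bot_mul, Submodule.bot_mul]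
  · rw [hpow p.2 (by omega), Submodule.mul_bot]

/-- Products of submodules that commute modulo `J` do not depend on the order, modulo `J`. -/
theorem list_prod_le_of_perm {V : A → Submodule R E} {J : Submodule R E}
    (hJ : ∀ a, V a * J ≤ J) (hcomm : ∀ a b P, (∃ l : List A, P = (l.map V).prod) →
      V a * (V b * P) ≤ V b * (V a * P) ⊔ J) {l l' : List A} (h : l.Perm l') :
    (l.map V).prod ≤ (l'.map V).prod ⊔ J := by
  induction h with
  | nil => exact le_sup_left
  | cons x _ ih =>
    rw [List.map_cons, List.prod_cons, List.map_cons, List.prod_cons]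
    refine ((mul_le_mul' le_rfl ih)).trans ?_
    rw [Submodule.mul_sup]
    exact sup_le_sup_left (hJ x) _
  | swap x y l =>
    simp only [List.map_cons, List.prod_cons]
    exact hcomm y x _ ⟨l, rfl⟩
  | trans _ _ ih₁ ih₂ => exact ih₁.trans (sup_le ih₂ le_sup_right)

theorem exists_perm_replicate_append {A : Type*} [DecidableEq A] {l : List A} {k : ℕ} {a : A}
    (h : k ≤ l.count a) : ∃ l', l.Perm (List.replicate k a ++ l') := by
  obtain ⟨l', hl'⟩ := (List.replicate_sublist_iff.2 h).exists_perm_append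
  exact ⟨l', hl'⟩

variable [AddCommGroup A]

/-- A solvable Lie family of nilpotent submodules with finite support generates a nilpotent
algebra. -/
theorem iSup_pow_eq_bot_of_solvable {S : Finset A} {d k : ℕ} (hd : S.card ≤ d) (m : ℕ) :
    ∀ V : A → Submodule R E, IsLieFamily (L := E) V → (∀ a ∉ S, V a = ⊥) → (∀ a, V a ^ k = ⊥) →
      (derivedFamily (L := E))^[m] V = ⊥ → (⨆ a, V a) ^ (d * k + 1) ^ m = ⊥ := by
  classical
  induction m with
  | zero =>
    intro V _ _ _ h
    simp only [Function.iterate_zero, id_eq] at h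
    simp [h]
  | succ m ih =>
    intro V hV hS hk hm
    set Y := ⨆ a, derivedFamily (L := E) V a with hY
    set X := ⨆ a, V a with hX
    set n := (d * k + 1) ^ m with hn
    have hYn : Y ^ n = ⊥ := by
      refine ih _ hV.derivedFamily (fun a ha => ?_) (fun a => ?_) hm
      · exact le_bot_iff.1 ((hV.derivedFamily_le a).trans (hS a ha).le)
      · exact le_bot_iff.1 ((pow_le_pow_left' (hV.derivedFamily_le a) k).trans (hk a).le)
    have hcomm : ∀ a b, V a * V b ≤ V b * V a ⊔ Y := fun a b =>
      mul_le_of_lie_le ((lieProd_le_derivedFamily (L := E) V a b).trans (le_iSup _ _))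
    set W : Submodule R E := ⨆ i : ℕ, X ^ i with hW
    have h1W : 1 ≤ W := by simpa using le_iSup (fun i : ℕ => X ^ i) 0
    have hXW : X ≤ W := by simpa using le_iSup (fun i : ℕ => X ^ i) 1
    have hWW : W * W ≤ W := by
      simp only [hW, Submodule.iSup_mul, Submodule.mul_iSup]
      exact iSup_le fun i => iSup_le fun j => by
        rw [← pow_add]; exact le_iSup (fun i : ℕ => X ^ i) _
    -- `Y * W` is the ideal generated by the derived part: moving X past Y costs only a commutator
    -- in Y.
    have hXY : X * (Y * W) ≤ Y * W := by
      have h1 : X * Y ≤ Y * X ⊔ Y := by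
        rw [hX, Submodule.iSup_mul, ← hX]
        refine iSup_le fun a => ?_
        rw [hY, Submodule.mul_iSup, ← hY]
        refine iSup_le fun b => (mul_le_of_lie_le (W := Y) ?_).trans
          (sup_le_sup_right (mul_le_mul' (le_iSup _ b) (le_iSup V a)) Y)
        exact (lieProd_mono le_rfl (hV.derivedFamily_le b)).trans
          ((lieProd_le_derivedFamily (L := E) V a b).trans (le_iSup _ _))
      rw [← mul_assoc]
      refine ((mul_le_mul' h1 le_rfl)).trans ?_
      rw [Submodule.sup_mul, mul_assoc]
      exact sup_le (mul_le_mul' le_rfl (((mul_le_mul' hXW le_rfl)).trans hWW)) le_rfl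
    have hWY : W * (Y * W) ≤ Y * W := by
      rw [hW, Submodule.iSup_mul, ← hW]
      refine iSup_le fun i => ?_
      induction i with
      | zero => simp
      | succ i ihi =>
        rw [pow_succ, mul_assoc]
        exact ((mul_le_mul' le_rfl hXY)).trans ihi
    have hprodW : ∀ l : List A, (l.map V).prod ≤ W := by
      intro l
      induction l with
      | nil => simpa using h1W
      | cons a l ihl =>
        rw [List.map_cons, List.prod_cons]
        exact (mul_le_mul' ((le_iSup V a).trans hXW) ihl).trans hWW
    have hXN : X ^ (d * k + 1) ≤ Y * W := by
      have := Submodule.iSup_pow_mul_le V (Y * W) (d * k + 1) 1 fun l hl => ?_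
      · simpa using this
      rw [mul_one]
      by_cases hlS : ∀ a ∈ l, a ∈ S
      -- Pigeonhole: among d k + 1 letters from at most d degrees, one occurs k times. Collecting
      -- its copies modulo `Y * W` produces `V a ^ k = ⊥`.
      · obtain ⟨a, ha⟩ : ∃ a, k ≤ l.count a := by
          by_contra! hlt
          have h1 : l.length = ∑ a ∈ S, l.count a := by
            rw [← Multiset.coe_card, ← Multiset.sum_count_eq_card (s := S) (by simpa using hlS)]
            simp
          have h2 : ∑ a ∈ S, l.count a ≤ S.card * k := by
            simpa using Finset.sum_le_card_nsmul S _ k fun a _ => (hlt a).le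
          have h3 := Nat.mul_le_mul_right k hd
          omega
        obtain ⟨l', hl'⟩ := exists_perm_replicate_append ha
        refine (list_prod_le_of_perm (J := Y * W) ?_ ?_ hl').trans (sup_le ?_ le_rfl)
        · exact fun a => (mul_le_mul' (le_iSup V a) le_rfl).trans hXY
        · rintro a b _ ⟨l, rfl⟩
          rw [← mul_assoc, ← mul_assoc]
          refine (mul_le_mul' (hcomm a b) le_rfl).trans ?_
          rw [Submodule.sup_mul]
          exact sup_le_sup_left (mul_le_mul' le_rfl (hprodW l)) _
        · simp [hk]
      · push Not at hlS
        obtain ⟨a, hal, haS⟩ := hlS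
        have : (l.map V).prod = 0 := List.prod_eq_zero (List.mem_map.2 ⟨a, hal, hS a haS⟩)
        rw [this]
        exact bot_le
    have hXj : ∀ j, X ^ ((d * k + 1) * j) ≤ Y ^ j * W := by
      intro j
      induction j with
      | zero => simpa using h1W
      | succ j ihj =>
        rw [mul_add, mul_one, pow_add]
        refine (mul_le_mul' ihj hXN).trans ?_
        rw [mul_assoc, pow_succ Y j, mul_assoc]
        exact (mul_le_mul' le_rfl hWY)
    have := hXj n
    rw [hYn, Submodule.bot_mul] at this
    rw [pow_succ', ← hn]
    exact le_bot_iff.1 this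

end Solvable

/-! ### Nilpotency for finite support. -/

section FiniteSupport

attribute [local instance] LieRing.ofAssociativeRing

/-- Auxiliary form of `exists_iSup_pow_eq_bot`, for a support contained in the subgroup generated by
`j` elements. -/
theorem exists_iSup_pow_eq_bot_of_closure (d k j : ℕ) : ∃ n : ℕ, ∀ (R : Type*) [CommRing R]
    (E : Type*) [Ring E] [Algebra R E] (A : Type*) [AddCommGroup A] (V : A → Submodule R E)
    (S : Finset A) (T : List A), IsLieFamily (L := E) V → (∀ a ∉ S, V a = ⊥) → S.card ≤ d →
    (∀ a, V a ^ k = ⊥) → T.length = j → (∀ s ∈ S, s ∈ AddSubgroup.closure {a | a ∈ T}) →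
    (⨆ a, V a) ^ n = ⊥ := by
  classical
  induction j with
  | zero =>
    refine ⟨k, fun R _ E _ _ A _ V S T hV hS hd hk hT hST => ?_⟩
    rw [List.length_eq_zero_iff] at hT
    subst hT
    have h0 : ∀ s ∈ S, s = 0 := fun s hs => by simpa using hST s hs
    have : ⨆ a, V a ≤ V 0 := iSup_le fun a => by
      by_cases ha : a ∈ S
      · rw [h0 a ha]
      · rw [hS a ha]; exact bot_le
    exact le_bot_iff.1 ((pow_le_pow_left' this k).trans (hk 0).le)
  | succ j ih =>
    obtain ⟨n, hn⟩ := ih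
    refine ⟨(d * k + 1) ^ (2 * n + krekninBound (2 * n) d),
      fun R _ E _ _ A _ V S T hV hS hd hk hT hST => ?_⟩
    obtain ⟨g, T, rfl⟩ := List.exists_cons_of_length_eq_add_one hT
    set B := AddSubgroup.closure {a | a ∈ T} with hB
    let V₁ : A → Submodule R E := fun a => if a ∈ B then V a else ⊥
    have hV₁le : V₁ ≤ V := fun a => by
      by_cases ha : a ∈ B <;> simp [V₁, ha]
    have hV₁mem : ∀ a ∈ B, V₁ a = V a := fun a ha => by simp [V₁, ha]
    have hV₁bot : ∀ a ∉ B, V₁ a = ⊥ := fun a ha => by simp [V₁, ha]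
    have hV₁ : IsLieFamily (L := E) V₁ := fun s t => by
      by_cases hs : s ∈ B
      · by_cases ht : t ∈ B
        · rw [hV₁mem s hs, hV₁mem t ht, hV₁mem _ (add_mem hs ht)]
          exact hV s t
        · rw [hV₁bot t ht, lieProd_bot]
          exact bot_le
      · rw [hV₁bot s hs, lieProd_comm, lieProd_bot]
        exact bot_le
    have hX₁ : (⨆ a, V₁ a) ^ n = ⊥ := by
      refine hn R E A V₁ (S.filter (· ∈ B)) T hV₁ (fun a ha => ?_)
        ((Finset.card_filter_le _ _).trans hd)
        (fun a => le_bot_iff.1 ((pow_le_pow_left' (hV₁le a) k).trans (hk a).le)) (by simpa using hT)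
        fun s hs => (Finset.mem_filter.1 hs).2
      by_cases haB : a ∈ B
      · rw [hV₁mem a haB, hS a fun h => ha (Finset.mem_filter.2 ⟨h, haB⟩)]
      · exact hV₁bot a haB
    -- Coarsening to A ⧸ B makes the support cyclic, generated by the image of g; the zero component
    -- is the sum of the `V₁ a`, nilpotent by induction.
    let W : A ⧸ B → Submodule R E := fun c => ⨆ (a : A) (_ : (a : A ⧸ B) = c), V a
    have hVW : ∀ a, V a ≤ W (QuotientAddGroup.mk' B a) := fun a =>
      le_iSup₂ (f := fun (b : A) (_ : (b : A ⧸ B) = a) => V b) a rfl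
    have hW : IsKreknin (L := E) (S.image (QuotientAddGroup.mk' B)) (2 * n) W := by
      refine ⟨fun s t => ?_, fun c hc => ?_, fun c => ?_⟩
      · simp only [W, lieProd_iSup_left, lieProd_iSup_right]
        refine iSup₂_le fun a ha => iSup₂_le fun b hb => (hV _ _).trans ?_
        rw [← ha, ← hb]
        exact hVW _
      · refine le_bot_iff.1 (iSup₂_le fun a ha => (hS a fun h => hc ?_).le)
        exact Finset.mem_image.2 ⟨a, h, ha⟩
      · have hW0 : W 0 ≤ ⨆ a, V₁ a := iSup₂_le fun a ha => by
          rw [← hV₁mem a ((QuotientAddGroup.eq_zero_iff a).1 ha)]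
          exact le_iSup V₁ a
        exact le_bot_iff.1 ((lieProd_iterate_mono hW0 le_rfl _).trans
          (lieProd_iterate_eq_bot hX₁ _).le)
    obtain ⟨ρ, hρ⟩ := exists_kreknin_rank (QuotientAddGroup.mk' B g)
      (S.image (QuotientAddGroup.mk' B)) fun s hs => by
        obtain ⟨a, ha, rfl⟩ := Finset.mem_image.1 hs
        have hle : AddSubgroup.closure {a | a ∈ g :: T} ≤
            (AddSubgroup.zmultiples (QuotientAddGroup.mk' B g)).comap
              (QuotientAddGroup.mk' B) := by
          rw [AddSubgroup.closure_le]
          intro b hb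
          rcases List.mem_cons.1 hb with rfl | hb
          · exact AddSubgroup.mem_zmultiples _
          · have : QuotientAddGroup.mk' B b = 0 :=
              (QuotientAddGroup.eq_zero_iff b).2 (AddSubgroup.subset_closure hb)
            change QuotientAddGroup.mk' B b ∈ AddSubgroup.zmultiples (QuotientAddGroup.mk' B g)
            rw [this]
            exact zero_mem _
        exact hle (hST a ha)
    have hWbot := hW.iterate_eq_bot hρ (Finset.card_image_le.trans hd)
    refine iSup_pow_eq_bot_of_solvable hd _ V hV hS hk (funext fun a => le_bot_iff.1 ?_)
    refine (derivedFamily_iterate_le_of_le (L := E) (QuotientAddGroup.mk' B) hVW _ a).trans ?_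
    rw [hWbot]
    exact le_rfl

/-- A Lie family of nilpotent submodules of an associative algebra with finite support generates a
nilpotent algebra, with a bound that depends only on the size of the support and the nilpotency
index of the components. -/
theorem exists_iSup_pow_eq_bot (d k : ℕ) : ∃ n : ℕ, ∀ (R : Type*) [CommRing R]
    (E : Type*) [Ring E] [Algebra R E] (A : Type*) [AddCommGroup A] (V : A → Submodule R E)
    (S : Finset A), IsLieFamily (L := E) V → (∀ a ∉ S, V a = ⊥) → S.card ≤ d →
    (∀ a, V a ^ k = ⊥) → (⨆ a, V a) ^ n = ⊥ := by
  obtain ⟨n, hn⟩ := exists_iSup_pow_eq_bot_of_closure d k d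
  -- The elements of the support are themselves generators; zeros pad the list to length exactly d.
  refine ⟨n, fun R _ E _ _ A _ V S hV hS hd hk => hn R E A V S
    (S.toList ++ List.replicate (d - S.card) 0) hV hS hd hk ?_ fun s hs =>
      AddSubgroup.subset_closure ?_⟩
  · simp; omega
  · simp [hs]

end FiniteSupport

/-! ### Submodules generated by almost centralized elements. -/

section WordSpace

attribute [local instance] LieRing.ofAssociativeRing

variable {R L M A : Type*} [CommRing R] [LieRing L] [LieAlgebra R L] [AddCommGroup M] [Module R M]
  [LieRingModule L M] [LieModule R L M]

/-- The span of the elements `⁅x₁, ⁅x₂, …, ⁅xₙ, u⁆⁆⁆`, where `xᵢ` runs over the component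
of degree `aᵢ`. -/
def wordSpace (ℒ : A → Submodule R L) (u : M) : List A → Submodule R M
  | [] => Submodule.span R {u}
  | a :: l => lieProd (ℒ a) (wordSpace ℒ u l)

theorem wordSpace_append_singleton {ℒ : A → Submodule R L} {u : M} {b : A}
    (hb : ∀ x ∈ ℒ b, ⁅x, u⁆ = 0) : ∀ p : List A, wordSpace ℒ u (p ++ [b]) = ⊥
  | [] => le_bot_iff.1 <| lieProd_le.2 fun x hx m hm => by
    obtain ⟨r, rfl⟩ := Submodule.mem_span_singleton.1 hm
    rw [lie_smul, hb x hx, smul_zero]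
    exact zero_mem _
  | c :: p => by
    rw [List.cons_append, wordSpace, wordSpace_append_singleton hb p, lieProd_bot]

theorem wordSpace_replicate_append (ℒ : A → Submodule R L) (u : M) (b : A) (l : List A) (k : ℕ) :
    wordSpace ℒ u (List.replicate k b ++ l) = (lieProd (ℒ b))^[k] (wordSpace ℒ u l) := by
  induction k with
  | zero => rfl
  | succ k ih => rw [List.replicate_succ, List.cons_append, wordSpace, ih,
      Function.iterate_succ_apply']

/-- The submodule generated by `u`. -/
def wordSubmodule (ℒ : A → Submodule R L) (htop : ⨆ a, ℒ a = ⊤) (u : M) : LieSubmodule R L M where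
  __ := ⨆ l, wordSpace ℒ u l
  lie_mem := by
    intro x m hm
    have hx : x ∈ ⨆ a, ℒ a := htop ▸ Submodule.mem_top
    have h : lieProd (⨆ a, ℒ a) (⨆ l, wordSpace ℒ u l) ≤ ⨆ l, wordSpace ℒ u l := by
      simp only [lieProd_iSup_left, lieProd_iSup_right]
      exact iSup_le fun l => iSup_le fun a => le_iSup (wordSpace ℒ u) (a :: l)
    exact h (lie_mem_lieProd hx hm)

theorem mem_wordSubmodule {ℒ : A → Submodule R L} {htop : ⨆ a, ℒ a = ⊤} {u m : M} :
    m ∈ wordSubmodule ℒ htop u ↔ m ∈ ⨆ l, wordSpace ℒ u l :=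
  Iff.rfl

theorem mem_ucs_of_pow_eq_bot (I : LieSubmodule R L M) (X : Submodule R (Module.End R I))
    (hX : ∀ x, LieModule.toEnd R L I x ∈ X) (j : ℕ) :
    ∀ m : I, (∀ f ∈ X ^ j, f m = 0) → (m : M) ∈ (⊥ : LieSubmodule R L M).ucs j := by
  induction j with
  | zero =>
    intro m h
    have h1 : X ^ 0 = 1 := pow_zero X
    have := h 1 (h1 ▸ Submodule.one_le.1 le_rfl)
    simpa using this
  | succ j ih =>
    intro m h
    rw [LieSubmodule.ucs_succ, LieSubmodule.mem_normalizer]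
    intro x
    refine ih ⁅x, m⁆ fun f hf => ?_
    exact h (f * LieModule.toEnd R L I x) (by
      have h1 : X ^ (j + 1) = X ^ j * X := pow_succ X j
      rw [h1]; exact Submodule.mul_mem_mul hf (hX x))

variable [AddCommGroup A]

/-- The Jacobi identity: the error merges two letters, so it is a shorter word of the same degree
sum. -/
theorem wordSpace_append_swap_le {ℒ : A → Submodule R L} (hL : IsLieFamily ℒ) (u : M) (a b : A)
    (q : List A) : ∀ p : List A, wordSpace ℒ u (p ++ a :: b :: q) ≤
      wordSpace ℒ u (p ++ b :: a :: q) ⊔ wordSpace ℒ u (p ++ (a + b) :: q)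
  | [] => lieProd_le.2 fun x hx m hm => by
    have h : lieProd (ℒ b) (wordSpace ℒ u q) ≤ (wordSpace ℒ u (b :: a :: q) ⊔
        wordSpace ℒ u ((a + b) :: q)).comap (LieModule.toEnd R L M x) :=
      lieProd_le.2 fun y hy m hm => by
        rw [Submodule.mem_comap, LieModule.toEnd_apply_apply, leibniz_lie]
        exact add_mem (Submodule.mem_sup_right (lie_mem_lieProd (hL.lie_mem hx hy) hm))
          (Submodule.mem_sup_left (lie_mem_lieProd hy (lie_mem_lieProd hx hm)))
    exact h hm
  | c :: p => by
    have := lieProd_mono (le_refl (ℒ c)) (wordSpace_append_swap_le hL u a b q p)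
    rwa [lieProd_sup] at this

theorem wordSpace_le_of_perm {ℒ : A → Submodule R L} (hL : IsLieFamily ℒ) (u : M)
    {l l' : List A} (h : l.Perm l') : ∀ p : List A,
      (∀ r : List A, r.length < (p ++ l).length → r.sum = (p ++ l).sum → wordSpace ℒ u r = ⊥) →
      wordSpace ℒ u (p ++ l) ≤ wordSpace ℒ u (p ++ l') := by
  induction h with
  | nil => exact fun _ _ => le_rfl
  | cons x _ ih =>
    intro p hp
    have := ih (p ++ [x]) (by simpa using hp)
    simpa using this
  | swap x y l =>
    intro p hp
    refine (wordSpace_append_swap_le hL u y x l p).trans (sup_le le_rfl ?_)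
    rw [hp _ (by simp) (by simp [add_assoc])]
    exact bot_le
  | trans h₁ _ ih₁ ih₂ =>
    intro p hp
    refine (ih₁ p hp).trans (ih₂ p fun r hr hs => hp r ?_ ?_)
    · simpa [h₁.length_eq] using hr
    · rw [hs, List.sum_append, List.sum_append, h₁.sum_eq]

/-- An element annihilated by all but `d` components, which act nilpotently, generates a submodule
with boundedly many components. -/
theorem exists_finset_wordSpace_eq_bot {ℒ : A → Submodule R L} (hL : IsLieFamily ℒ) {u : M}
    {D : Finset A} {d k : ℕ} (hd : D.card ≤ d) (hD : ∀ b ∉ D, ∀ x ∈ ℒ b, ⁅x, u⁆ = 0)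
    (hk : ∀ b, (lieProd (ℒ b))^[k] (⊤ : Submodule R M) = ⊥) :
    ∃ S : Finset A, S.card ≤ (k + 1) ^ d ∧ ∀ l : List A, l.sum ∉ S → wordSpace ℒ u l = ⊥ := by
  classical
  -- By induction on length, shorter words of a degree outside this set vanish, so letters permute
  -- freely. A letter outside `D` moved next to u gives 0, as do k copies of one letter moved to the
  -- front. Surviving words thus have letters in `D` with multiplicities at most k.
  refine ⟨(Finset.univ : Finset (D → Fin (k + 1))).image fun f => ∑ b : D, (f b : ℕ) • (b : A),
    ?_, ?_⟩
  · refine Finset.card_image_le.trans ?_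
    simpa using Nat.pow_le_pow_right (Nat.succ_pos k) hd
  · intro l
    induction hl : l.length using Nat.strong_induction_on generalizing l with
    | _ n ih =>
      intro hS
      subst hl
      have hshort : ∀ r : List A, r.length < ([] ++ l).length → r.sum = ([] ++ l).sum →
          wordSpace ℒ u r = ⊥ := fun r hr hs =>
        ih r.length hr r rfl (by rw [hs]; exact hS)
      by_cases hlD : ∀ b ∈ l, b ∈ D
      · by_cases hcount : ∀ b, l.count b < k + 1
        · refine absurd (Finset.mem_image.2 ⟨fun b => ⟨l.count b.1, hcount b⟩,
            Finset.mem_univ _, ?_⟩) hS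
          rw [Finset.sum_list_count_of_subset l D fun b hb => hlD b (by simpa using hb)]
          exact Finset.sum_coe_sort D fun b => l.count b • b
        · push Not at hcount
          obtain ⟨b, hb⟩ := hcount
          obtain ⟨l', hl'⟩ := exists_perm_replicate_append (k := k) (by omega : k ≤ l.count b)
          have h := wordSpace_le_of_perm hL u hl' [] hshort
          rw [List.nil_append, List.nil_append, wordSpace_replicate_append] at h
          exact le_bot_iff.1 (h.trans ((lieProd_iterate_mono le_rfl le_top k).trans (hk b).le))
      · push Not at hlD
        obtain ⟨b, hb, hbD⟩ := hlD
        obtain ⟨s, t, rfl⟩ := List.append_of_mem hb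
        have hperm : (s ++ b :: t).Perm ((s ++ t) ++ [b]) :=
          List.perm_middle.trans (List.perm_append_singleton b _).symm
        have h := wordSpace_le_of_perm hL u hperm [] hshort
        rw [List.nil_append, List.nil_append, wordSpace_append_singleton (hD b hbD)] at h
        exact le_bot_iff.1 h

/-- The submodule generated by u lives in a bounded set of degrees, so only boundedly many
components act nontrivially on it, each nilpotently; the associative algebra they generate is
nilpotent of bounded index. -/
theorem exists_mem_ucs_bot (d k : ℕ) : ∃ n : ℕ, ∀ (R : Type*) [CommRing R] (L : Type*) [LieRing L]
    [LieAlgebra R L] (M : Type*) [AddCommGroup M] [Module R M] [LieRingModule L M] [LieModule R L M]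
    (A : Type*) [AddCommGroup A] (ℒ : A → Submodule R L), IsLieFamily ℒ → ⨆ a, ℒ a = ⊤ →
    (∀ b, (lieProd (ℒ b))^[k] (⊤ : Submodule R M) = ⊥) → ∀ (u : M) (D : Finset A), D.card ≤ d →
    (∀ b ∉ D, ∀ x ∈ ℒ b, ⁅x, u⁆ = 0) → u ∈ (⊥ : LieSubmodule R L M).ucs n := by
  classical
  obtain ⟨n, hn⟩ := exists_iSup_pow_eq_bot ((k + 1) ^ d * (k + 1) ^ d) k
  refine ⟨n, fun R _ L _ _ M _ _ _ _ A _ ℒ hL htop hk u D hd hD => ?_⟩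
  obtain ⟨S, hS, hSbot⟩ := exists_finset_wordSpace_eq_bot hL hd hD hk
  set I := wordSubmodule ℒ htop u with hI
  let V : A → Submodule R (Module.End R I) := fun a =>
    (ℒ a).map (LieModule.toEnd R L I : L →ₗ[R] Module.End R I)
  -- A component acting nontrivially carries some degree in S to another one, so its own degree is a
  -- difference of two elements of S.
  have hX := hn R (Module.End R I) A V (Finset.image₂ (· - ·) S S) ?_ ?_ ?_ ?_
  · have hu : u ∈ I := mem_wordSubmodule.2
      (Submodule.mem_iSup_of_mem [] (Submodule.mem_span_singleton_self u))
    refine mem_ucs_of_pow_eq_bot I (⨆ a, V a) (fun x => ?_) n ⟨u, hu⟩ fun f hf => ?_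
    · have hx : x ∈ ⨆ a, ℒ a := htop ▸ Submodule.mem_top
      have := Submodule.mem_map_of_mem (f := (LieModule.toEnd R L I : L →ₗ[R] Module.End R I)) hx
      rwa [Submodule.map_iSup] at this
    · rw [hX, Submodule.mem_bot] at hf
      rw [hf, LinearMap.zero_apply]
  · intro s t
    refine lieProd_le.2 ?_
    rintro _ ⟨x, hx, rfl⟩ _ ⟨y, hy, rfl⟩
    exact ⟨⁅x, y⁆, hL.lie_mem hx hy, LieHom.map_lie (LieModule.toEnd R L I) x y⟩
  · intro a ha
    refine le_bot_iff.1 ?_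
    rintro _ ⟨x, hx, rfl⟩
    rw [Submodule.mem_bot]
    ext ⟨m, hm⟩
    have h : lieProd (ℒ a) (⨆ l, wordSpace ℒ u l) = ⊥ := by
      rw [lieProd_iSup_right]
      refine le_bot_iff.1 (iSup_le fun l => ?_)
      by_cases h1 : l.sum ∈ S
      · have h2 : (a :: l).sum ∉ S := fun h2 => ha (Finset.mem_image₂.2 ⟨_, h2, _, h1, by simp⟩)
        exact (hSbot _ h2).le
      · rw [hSbot l h1, lieProd_bot]
    have := lie_mem_lieProd hx (mem_wordSubmodule.1 hm)
    rw [h, Submodule.mem_bot] at this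
    simpa using this
  · exact (Finset.card_image₂_le _ _ _).trans (Nat.mul_le_mul hS hS)
  · intro a
    have h : ∀ j, ∀ f ∈ V a ^ j, ∀ m : I, (f m : M) ∈ (lieProd (ℒ a))^[j] (⊤ : Submodule R M) := by
      intro j
      induction j with
      | zero => simp
      | succ j ih =>
        intro f hf m
        have h1 : V a ^ (j + 1) = V a * V a ^ j := pow_succ' (V a) j
        rw [h1] at hf
        rw [Function.iterate_succ_apply']
        induction hf using Submodule.mul_induction_on' with
        | mem_mul_mem f hf g hg =>
          obtain ⟨x, hx, rfl⟩ := hf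
          exact lie_mem_lieProd hx (ih g hg m)
        | add f _ g _ hf hg => simpa using add_mem hf hg
    refine le_bot_iff.1 fun f hf => ?_
    rw [Submodule.mem_bot]
    ext m
    have := h k f hf m
    rw [hk, Submodule.mem_bot] at this
    simpa using this

/-- If `u` is centralized modulo `N` by all but `d` components, then it lies in a bounded term of
the upper central series over `N`. -/
theorem exists_mem_ucs (d k : ℕ) : ∃ n : ℕ, ∀ (R : Type*) [CommRing R] (L : Type*) [LieRing L]
    [LieAlgebra R L] (M : Type*) [AddCommGroup M] [Module R M] [LieRingModule L M] [LieModule R L M]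
    (A : Type*) [AddCommGroup A] (ℒ : A → Submodule R L), IsLieFamily ℒ → ⨆ a, ℒ a = ⊤ →
    (∀ b, (lieProd (ℒ b))^[k] (⊤ : Submodule R M) = ⊥) → ∀ (N : LieSubmodule R L M) (u : M)
    (D : Finset A), D.card ≤ d → (∀ b ∉ D, ∀ x ∈ ℒ b, ⁅x, u⁆ ∈ N) → u ∈ N.ucs n := by
  obtain ⟨n, hn⟩ := exists_mem_ucs_bot d k
  refine ⟨n, fun R _ L _ _ M _ _ _ _ A _ ℒ hL htop hk N u D hd hD => ?_⟩
  have hucs : ∀ j, ∀ m : M, LieSubmodule.Quotient.mk' N m ∈ (⊥ : LieSubmodule R L (M ⧸ N)).ucs j →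
      m ∈ N.ucs j := by
    intro j
    induction j with
    | zero => intro m hm; simpa using hm
    | succ j ih =>
      intro m hm
      rw [LieSubmodule.ucs_succ, LieSubmodule.mem_normalizer] at hm ⊢
      intro x
      exact ih _ (by rw [LieModuleHom.map_lie]; exact hm x)
  refine hucs n u (hn R L (M ⧸ N) A ℒ hL htop (fun b => ?_) _ D hd fun b hb x hx => ?_)
  · have h : ∀ j, (lieProd (ℒ b))^[j] (⊤ : Submodule R (M ⧸ N)) ≤
        ((lieProd (ℒ b))^[j] (⊤ : Submodule R M)).map
          (LieSubmodule.Quotient.mk' N : M →ₗ[R] M ⧸ N) := by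
      intro j
      induction j with
      | zero =>
        intro y _
        obtain ⟨m, rfl⟩ := LieSubmodule.Quotient.surjective_mk' N y
        exact ⟨m, Submodule.mem_top, rfl⟩
      | succ j ih =>
        rw [Function.iterate_succ_apply', Function.iterate_succ_apply']
        refine lieProd_le.2 fun x hx y hy => ?_
        obtain ⟨m, hm, rfl⟩ := ih hy
        exact ⟨⁅x, m⁆, lie_mem_lieProd hx hm, LieModuleHom.map_lie _ x m⟩
    have := h k
    rw [hk, Submodule.map_bot] at this
    exact le_bot_iff.1 this
  · rw [← LieModuleHom.map_lie]
    exact (LieSubmodule.Quotient.mk_eq_zero' (N := N)).2 (hD b hb x hx)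

end WordSpace

/-! ### Independent lists of degrees. -/

section Independence

variable (G : Type*) {A : Type*} [Group G] [AddCommGroup A] [DistribMulAction G A]

/-- The sums of elements in the orbits of the entries of a list. -/
def orbitSums : List A → Set A
  | [] => {0}
  | a :: l => {b | ∃ g : G, ∃ o ∈ orbitSums l, b = g • a + o}

/-- The sums of images of the entries of a list under elements of `G`, not all of them trivial. -/
def twistedSums : List A → Set A
  | [] => ∅
  | a :: l => {b | (∃ g : G, g ≠ 1 ∧ ∃ o ∈ orbitSums G l, b = g • a + o) ∨
      ∃ o ∈ twistedSums l, b = a + o}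

/-- A list of elements is independent if its sum cannot be written in another way as a sum of
elements in the orbits of its entries. -/
def IsOrbitIndependent (l : List A) : Prop :=
  l.sum ∉ twistedSums G l

theorem exists_finset_orbitSums_subset [Finite G] (l : List A) :
    ∃ s : Finset A, s.card ≤ Nat.card G ^ l.length ∧ orbitSums G l ⊆ s := by
  classical
  have := Fintype.ofFinite G
  induction l with
  | nil => exact ⟨{0}, by simp, by simp [orbitSums]⟩
  | cons a l ih =>
    obtain ⟨s, hs, hsub⟩ := ih
    refine ⟨Finset.image₂ (fun g o => g • a + o) (Finset.univ : Finset G) s, ?_, ?_⟩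
    · refine (Finset.card_image₂_le _ _ _).trans ?_
      rw [List.length_cons, pow_succ', Finset.card_univ, ← Nat.card_eq_fintype_card]
      exact Nat.mul_le_mul_left _ hs
    · rintro _ ⟨g, o, ho, rfl⟩
      exact Finset.mem_coe.2 (Finset.mem_image₂_of_mem (Finset.mem_univ g) (hsub ho))

variable {G}

/-- An independent list can be extended by all but boundedly many elements. -/
theorem IsOrbitIndependent.exists_finset [Finite G]
    (hG : ∀ g : G, g ≠ 1 → ∀ a : A, g • a = a → a = 0) {l : List A}
    (hl : IsOrbitIndependent G l) : ∃ D : Finset A, D.card ≤ Nat.card G ^ (l.length + 1) ∧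
      ∀ b ∉ D, IsOrbitIndependent G (b :: l) := by
  classical
  have := Fintype.ofFinite G
  obtain ⟨s, hs, hsub⟩ := exists_finset_orbitSums_subset G l
  -- For g ≠ 1 the equation has at most one solution b, since the difference of two solutions is
  -- fixed by g. The default 0 and the values at g = 1 merely enlarge `D`.
  let F : G → A → A := fun g o =>
    if h : ∃ b : A, b + l.sum = g • b + o then h.choose else 0
  refine ⟨Finset.image₂ F Finset.univ s, ?_, fun b hb hdep => ?_⟩
  · refine (Finset.card_image₂_le _ _ _).trans ?_
    rw [pow_succ', Finset.card_univ, ← Nat.card_eq_fintype_card]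
    exact Nat.mul_le_mul_left _ hs
  · rcases hdep with ⟨g, hg, o, ho, h⟩ | ⟨o, ho, h⟩
    · rw [List.sum_cons] at h
      have hex : ∃ b : A, b + l.sum = g • b + o := ⟨b, h⟩
      have hF : F g o = b := by
        have h1 : F g o = hex.choose := dif_pos hex
        rw [h1, ← sub_eq_zero]
        refine hG g hg _ ?_
        have h2 := hex.choose_spec
        rw [smul_sub, sub_eq_sub_iff_add_eq_add]
        have e1 : g • hex.choose = hex.choose + l.sum - o := by rw [h2]; abel
        have e2 : g • b = b + l.sum - o := by rw [h]; abel
        rw [e1, e2]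
        abel
      exact hb (hF ▸ Finset.mem_image₂_of_mem (Finset.mem_univ g) (hsub ho))
    · rw [List.sum_cons] at h
      exact hl (add_left_cancel h ▸ ho)

end Independence

/-! ### Commutators of homogeneous elements and traces. -/

section Grading

variable {R L A : Type*} [CommRing R] [LieRing L] [LieAlgebra R L]

theorem exists_linearMap_leftNormed (R : Type*) {L : Type*} [CommRing R] [LieRing L]
    [LieAlgebra R L] (ys : List L) : ∃ f : L →ₗ[R] L, ∀ x, f x = leftNormed x ys := by
  induction ys with
  | nil => exact ⟨LinearMap.id, fun _ => rfl⟩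
  | cons y ys ih =>
    obtain ⟨f, hf⟩ := ih
    refine ⟨-(f ∘ₗ LieModule.toEnd R L L y), fun x => ?_⟩
    rw [LinearMap.neg_apply, LinearMap.comp_apply, LieModule.toEnd_apply_apply, ← map_neg,
      lie_skew, hf]
    rfl

/-- Skew-symmetry passes from left-normed commutators to iterated left actions. -/
theorem IsAdNilpotentOfIndex.lieProd_iterate_top {K : Submodule R L} {k : ℕ}
    (hK : IsAdNilpotentOfIndex K k) : (lieProd K)^[k] (⊤ : Submodule R L) = ⊥ := by
  have h : ∀ j, ∀ Q : Submodule R L,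
      (∀ x ∈ Q, ∀ ys : List L, ys.length = j → (∀ y ∈ ys, y ∈ K) → leftNormed x ys = 0) →
      (lieProd K)^[j] Q = ⊥ := by
    intro j
    induction j with
    | zero =>
      intro Q hQ
      exact (Submodule.eq_bot_iff _).2 fun x hx => hQ x hx [] rfl (by simp)
    | succ j ih =>
      intro Q hQ
      rw [Function.iterate_succ_apply]
      refine ih _ fun x hx ys hys hysK => ?_
      obtain ⟨f, hf⟩ := exists_linearMap_leftNormed R ys
      have hle : lieProd K Q ≤ LinearMap.ker f := lieProd_le.2 fun y hy m hm => by
        rw [LinearMap.mem_ker, ← lie_skew, map_neg, hf, neg_eq_zero]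
        exact hQ m hm (y :: ys) (by simp [hys]) (by simpa using ⟨hy, hysK⟩)
      rw [← hf]
      exact hle hx
  exact h k ⊤ fun x _ ys hys hysK => hK x ys hys hysK

/-- The span of the commutators of elements with the given degrees. -/
def commSpace (ℒ : A → Submodule R L) : List A → Submodule R L
  | [] => ⊤
  | [a] => ℒ a
  | a :: b :: l => lieProd (ℒ a) (commSpace ℒ (b :: l))

/-- The sum of the components with degrees in a set. -/
def degreeSpace (ℒ : A → Submodule R L) (s : Set A) : Submodule R L :=
  ⨆ a ∈ s, ℒ a

theorem le_degreeSpace {ℒ : A → Submodule R L} {s : Set A} {a : A} (ha : a ∈ s) :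
    ℒ a ≤ degreeSpace ℒ s :=
  le_iSup₂ (f := fun a (_ : a ∈ s) => ℒ a) a ha

variable [AddCommGroup A]

theorem commSpace_le {ℒ : A → Submodule R L} (hL : IsLieFamily ℒ) :
    ∀ l : List A, l ≠ [] → commSpace ℒ l ≤ ℒ l.sum
  | [], h => absurd rfl h
  | [a], _ => by simp [commSpace]
  | a :: b :: l, _ => (lieProd_mono le_rfl (commSpace_le hL (b :: l) (by simp))).trans (by
      rw [List.sum_cons]
      exact hL _ _)

theorem lieProd_degreeSpace_le {ℒ : A → Submodule R L} (hL : IsLieFamily ℒ) {a : A} {s t : Set A}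
    (h : ∀ b ∈ s, a + b ∈ t) : lieProd (ℒ a) (degreeSpace ℒ s) ≤ degreeSpace ℒ t := by
  rw [degreeSpace]
  simp only [lieProd_iSup_right]
  exact iSup₂_le fun b hb => (hL a b).trans (le_degreeSpace (h b hb))

variable {ℒ : A → Submodule R L} {H : Subgroup (L ≃ₗ⁅R⁆ L)} [DistribMulAction H A]

theorem IsGroupOfDoubleAut.apply_mem (hH : IsGroupOfDoubleAut ℒ H) (h : H) {a : A} {x : L}
    (hx : x ∈ ℒ a) : (h : L ≃ₗ⁅R⁆ L) x ∈ ℒ (h • a) := by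
  rw [← hH h a]
  exact ⟨x, hx, rfl⟩

theorem sum_apply_mem_lieFixedPoints [Fintype H] (x : L) :
    ∑ h : H, (h : L ≃ₗ⁅R⁆ L) x ∈ lieFixedPoints H := by
  intro φ hφ
  rw [map_sum]
  exact Fintype.sum_equiv (Equiv.mulLeft (⟨φ, hφ⟩ : H)) _ _ fun h => rfl

/-- Commutators of homogeneous elements are commutators of fixed points, up to components of twisted
degrees. -/
theorem commSpace_le_lowerCentralSeries_sup [Finite H] (hL : IsLieFamily ℒ)
    (hH : IsGroupOfDoubleAut ℒ H) : ∀ l : List A, ∀ a : A, commSpace ℒ (a :: l) ≤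
      ((LieModule.lowerCentralSeries R (lieFixedPoints H) (lieFixedPoints H)
        l.length).toSubmodule.map (lieFixedPoints H).toSubmodule.subtype ⊓ degreeSpace ℒ (orbitSums H (a :: l))) ⊔
      degreeSpace ℒ (twistedSums H (a :: l)) := by
  classical
  have := Fintype.ofFinite H
  -- Each x is its trace minus its nontrivial translates. The trace feeds the lower central series
  -- of the fixed points, the translates give twisted degrees.
  have hsplit : ∀ x : L, x = ∑ h : H, (h : L ≃ₗ⁅R⁆ L) x -
      ∑ h ∈ Finset.univ.erase (1 : H), (h : L ≃ₗ⁅R⁆ L) x := fun x => by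
    rw [← Finset.add_sum_erase _ _ (Finset.mem_univ (1 : H)), add_sub_cancel_right]
    rfl
  intro l
  induction l with
  | nil =>
    intro a x hx
    have hmem : ∀ h : H, ∀ s : Set A, h • a ∈ s → (h : L ≃ₗ⁅R⁆ L) x ∈ degreeSpace ℒ s :=
      fun h s hs => le_degreeSpace hs (hH.apply_mem h hx)
    rw [hsplit x]
    refine sub_mem (Submodule.mem_sup_left ⟨?_, ?_⟩) (Submodule.mem_sup_right ?_)
    · exact ⟨⟨_, sum_apply_mem_lieFixedPoints x⟩, by simp, rfl⟩
    · exact sum_mem fun h _ => hmem h _ ⟨h, 0, rfl, (add_zero _).symm⟩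
    · exact sum_mem fun h hh => hmem h _
        (Or.inl ⟨h, Finset.ne_of_mem_erase hh, 0, rfl, (add_zero _).symm⟩)
  | cons b l ih =>
    intro a
    refine (lieProd_mono le_rfl (ih b)).trans ?_
    rw [lieProd_sup]
    refine sup_le (lieProd_le.2 fun x hx z hz => ?_) (le_sup_of_le_right
      (lieProd_degreeSpace_le hL fun o ho => Or.inr ⟨o, ho, rfl⟩))
    obtain ⟨⟨z, hz, rfl⟩, hzO⟩ := hz
    have horb : ∀ h : H, ∀ s : Set A, (∀ o ∈ orbitSums H (b :: l), h • a + o ∈ s) →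
        ⁅(h : L ≃ₗ⁅R⁆ L) x, (z : L)⁆ ∈ degreeSpace ℒ s := fun h s hs =>
      lieProd_degreeSpace_le hL hs (lie_mem_lieProd (hH.apply_mem h hx) hzO)
    rw [hsplit x, sub_lie]
    refine sub_mem (Submodule.mem_sup_left ⟨?_, ?_⟩) (Submodule.mem_sup_right ?_)
    · refine ⟨⁅(⟨_, sum_apply_mem_lieFixedPoints x⟩ : lieFixedPoints H), z⁆, ?_, rfl⟩
      rw [List.length_cons]
      change _ ∈ LieModule.lowerCentralSeries R (lieFixedPoints H) (lieFixedPoints H) (l.length + 1)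
      rw [LieModule.lowerCentralSeries_succ]
      exact LieSubmodule.lie_mem_lie (LieSubmodule.mem_top _) hz
    · rw [sum_lie]
      exact sum_mem fun h _ => horb h _ fun o ho => ⟨h, o, ho, rfl⟩
    · rw [sum_lie]
      exact sum_mem fun h hh => horb h _ fun o ho =>
        Or.inl ⟨h, Finset.ne_of_mem_erase hh, o, ho, rfl⟩

/-- Commutators of homogeneous elements with independent degrees vanish if they are longer than the
nilpotency class of the fixed-point subalgebra. -/
theorem commSpace_eq_bot_of_isOrbitIndependent [Finite H] (hL : IsLieFamily ℒ) (hind : iSupIndep ℒ)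
    (hH : IsGroupOfDoubleAut ℒ H) {c : ℕ} (hc : IsLieNilpotentOfClass R (lieFixedPoints H) c)
    {l : List A} (hl : IsOrbitIndependent H l) (hlen : l.length = c + 1) : commSpace ℒ l = ⊥ := by
  obtain ⟨a, l, rfl⟩ := List.exists_cons_of_length_eq_add_one hlen
  have h1 := commSpace_le_lowerCentralSeries_sup hL hH l a
  have hlc : l.length = c := by simpa using hlen
  rw [hlc, show LieModule.lowerCentralSeries R (lieFixedPoints H) (lieFixedPoints H) c = ⊥ from hc,
    LieSubmodule.bot_toSubmodule, Submodule.map_bot, bot_inf_eq, bot_sup_eq] at h1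
  have h2 := commSpace_le hL (a :: l) (by simp)
  -- The commutator lies both in the component of its own degree and in a sum of other components.
  refine le_bot_iff.1 ((hind (a :: l).sum) h2 (h1.trans ?_))
  refine iSup₂_le fun t ht => le_iSup₂ (f := fun j (_ : j ≠ (a :: l).sum) => ℒ j) t ?_
  rintro rfl
  exact hl ht

end Grading

/-! ### Downward induction on length. -/

/-- Commutators of homogeneous elements with independent degrees lie in bounded terms of the upper
central series. -/
theorem exists_commSpace_le_ucs (q k c j : ℕ) : ∃ n : ℕ, ∀ (R : Type*) [CommRing R] (L : Type*)
    [LieRing L] [LieAlgebra R L] (A : Type*) [AddCommGroup A] (ℒ : A → Submodule R L)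
    (H : Subgroup (L ≃ₗ⁅R⁆ L)) [Finite H] [DistribMulAction H A], IsLieFamily ℒ →
    ⨆ a, ℒ a = ⊤ → iSupIndep ℒ → Nat.card H = q → IsGroupOfDoubleAut ℒ H →
    (∀ h : H, h ≠ 1 → ∀ a : A, h • a = a → a = 0) →
    (∀ a : A, IsAdNilpotentOfIndex (ℒ a) k) →
    IsLieNilpotentOfClass R (lieFixedPoints H) c →
    ∀ l : List A, IsOrbitIndependent H l → l.length + j = c + 1 →
      commSpace ℒ l ≤ ((⊥ : LieSubmodule R L L).ucs n).toSubmodule := by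
  induction j with
  | zero =>
    refine ⟨0, fun R _ L _ _ A _ ℒ H _ _ hL _ hind _ hH _ _ hc l hl hlen => ?_⟩
    rw [commSpace_eq_bot_of_isOrbitIndependent hL hind hH hc hl hlen]
    exact bot_le
  | succ j ih =>
    obtain ⟨n, hn⟩ := ih
    -- The list has length c + 1 - (j + 1), and one more power of q accounts for the new degree.
    obtain ⟨n', hn'⟩ := exists_mem_ucs (q ^ (c + 1 - (j + 1) + 1)) k
    refine ⟨n' + n, fun R _ L _ _ A _ ℒ H _ _ hL htop hind hq hH hfix hk hc l hl hlen u hu => ?_⟩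
    obtain ⟨D, hD, hDind⟩ := hl.exists_finset hfix
    have hl' : c + 1 - (j + 1) = l.length := by omega
    rw [hq, ← hl'] at hD
    rw [LieSubmodule.ucs_add]
    refine hn' R L L A ℒ hL htop (fun a => (hk a).lieProd_iterate_top) _ u D hD fun b hb x hx => ?_
    have h := hn R L A ℒ H hL htop hind hq hH hfix hk hc (b :: l) (hDind b hb)
      (by rw [List.length_cons]; omega)
    -- For the empty list u is arbitrary, but x already lies in the term of the upper central
    -- series, which is an ideal.
    cases l with
    | nil =>
      rw [← lie_skew]
      exact neg_mem (LieSubmodule.lie_mem _ (h hx))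
    | cons a l => exact h (lie_mem_lieProd hx hu)

theorem theorem1p2 :
    ∃ f : ℕ → ℕ → ℕ → ℕ,
      ∀ (R : Type*) [CommRing R] (L : Type*) [LieRing L] [LieAlgebra R L]
        (A : Type*) [AddCommGroup A] [DecidableEq A]
        (ℒ : A → Submodule R L) [GradedLieAlgebra ℒ]
        (H : Subgroup (L ≃ₗ⁅R⁆ L)) [Finite H] [DistribMulAction H A] (k c : ℕ),
        IsGroupOfDoubleAut ℒ H →
        (∀ h : H, h ≠ 1 → ∀ a : A, h • a = a → a = 0) →
        (∀ a : A, IsAdNilpotentOfIndex (ℒ a) k) →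
        IsLieNilpotentOfClass R (lieFixedPoints H) c →
        IsLieNilpotentOfClass R L (f (Nat.card H) k c) := by
  -- With j = c + 1 the list is empty; it is independent, and its `commSpace` is by convention all
  -- of `L`.
  choose f hf using fun q k c => exists_commSpace_le_ucs q k c (c + 1)
  refine ⟨f, fun R _ L _ _ A _ _ ℒ _ H _ _ k c hH hfix hk hc => ?_⟩
  have hint := DirectSum.Decomposition.isInternal ℒ
  have h := hf (Nat.card H) k c R L A ℒ H
    (fun s t => lieProd_le.2 fun x hx y hy => SetLike.GradedBracket.bracket_mem hx hy)
    hint.submodule_iSup_eq_top hint.submodule_iSupIndep rfl hH hfix hk hc [] (fun h => h) (by simp)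
  have htop : (⊥ : LieSubmodule R L L).ucs (f (Nat.card H) k c) = ⊤ :=
    eq_top_iff.2 fun x _ => h Submodule.mem_top
  exact le_bot_iff.1 ((LieSubmodule.ucs_eq_top_iff _ _).1 htop)
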